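/- Let $D\geq 2$ be an integer. For $a\in\mathbb{C}$ let $f_a(z)=az^D+1$. For integers $k\geq 2$, $n\geq 1$ and a divisor $d\geq 2$ of $D$, let $R_{k,n,d}\in\mathbb{C}[X]$ be the monic polynomial with simple roots whose roots are exactly the (finitely many) parameters $a\in\mathbb{C}$ such that - $0$ is preperiodic for $f_a$ with preperiod $k$ and period $n$ (that is, $k$ is the least integer $j\ge 0$ such that $f_a^{\circ j}(0)$ is periodic, and $n$ is the exact period of $f_a^{\circ k}(0)$), and - $f_a^{\circ(k+n-1)}(0)=\omega\, f_a^{\circ(k-1)}(0)$ for some primitive $d$-th root of unity $\omega$. Assume that $D=p^e$ is a power of a prime $p$, with $e\ge 1$. Then for all $k\geq 2$ and all divisors $d\geq 2$ of $D$, the polynomial $R_{k,2,d}$ has integer coefficients and is irreducible over $\mathbb{Q}$. -/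

import Mathlib

namespace UnicriticalPreperiodic

open Polynomial

/-- The unicritical polynomial map `f_a(z) = a z ^ D + 1` of `ℂ`, with critical point `0`. -/
def unicritical (D : ℕ) (a : ℂ) (z : ℂ) : ℂ := a * z ^ D + 1

/-- The point `z` is preperiodic for `f` with preperiod `k` and period `n`: `k` is the least integer
such that `f^k(z)` is periodic, and `n ≥ 1` is the exact period of the periodic point `f^k(z)`. -/
def IsPreperiodicWith {α : Type*} (f : α → α) (z : α) (k n : ℕ) : Prop :=
  IsLeast {j : ℕ | f^[j] z ∈ Function.periodicPts f} k ∧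
    Function.minimalPeriod f (f^[k] z) = n

/-- The parameters `a ∈ ℂ` such that `0` is preperiodic for `f_a` with preperiod `k` and period `n`,
and `f_a^(k+n-1)(0) = ω f_a^(k-1)(0)` for some primitive `d`-th root of unity `ω`.
(Used for `k ≥ 2` and `n ≥ 1`, where the subtractions are the usual ones.) -/
def params (D k n d : ℕ) : Set ℂ :=
  {a : ℂ | IsPreperiodicWith (unicritical D a) 0 k n ∧
    ∃ ω : ℂ, IsPrimitiveRoot ω d ∧
      (unicritical D a)^[k + n - 1] 0 = ω * (unicritical D a)^[k - 1] 0}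

/-- The monic polynomial `R_{k,n,d}` with simple roots, whose roots are the parameters in
`params D k n d`. That set is finite (`params_finite`), so this is a genuine product. -/
noncomputable def R (D k n d : ℕ) : ℂ[X] :=
  ∏ᶠ a ∈ params D k n d, (X - C a)

/-- The polynomial in `a` whose value is `f_a^n(0)`. -/
noncomputable def critOrbit (D : ℕ) : ℕ → ℂ[X]
  | 0 => 0
  | n + 1 => X * critOrbit D n ^ D + 1

theorem eval_critOrbit (D : ℕ) (a : ℂ) (n : ℕ) :
    (critOrbit D n).eval a = (unicritical D a)^[n] 0 := by
  induction n with
  | zero => simp [critOrbit]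
  | succ n ih => rw [Function.iterate_succ_apply']; simp [critOrbit, ih, unicritical]

theorem critOrbit_coeff_zero (D n : ℕ) : (critOrbit D (n + 1)).coeff 0 = 1 := by
  simp [critOrbit]

theorem natDegree_critOrbit_lt {D : ℕ} (hD : 1 ≤ D) (n : ℕ) :
    (critOrbit D (n + 1)).natDegree < (critOrbit D (n + 2)).natDegree := by
  have h0 : critOrbit D (n + 1) ≠ 0 := by
    intro h
    have := critOrbit_coeff_zero D n
    simp [h] at this
  have h1 : (critOrbit D (n + 2)).natDegree = D * (critOrbit D (n + 1)).natDegree + 1 := by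
    rw [critOrbit, ← C_1, natDegree_add_C, natDegree_X_mul (pow_ne_zero _ h0), natDegree_pow]
  rw [h1]
  nlinarith [Nat.zero_le (critOrbit D (n + 1)).natDegree]

theorem params_finite {D k n : ℕ} (hD : 1 ≤ D) (hk : 1 ≤ k) (hn : 1 ≤ n) (d : ℕ) :
    (params D k n d).Finite := by
  obtain ⟨k, rfl⟩ := Nat.exists_eq_add_of_le' hk
  have hmono : StrictMono fun j => (critOrbit D (j + 1)).natDegree :=
    strictMono_nat_of_lt_succ (natDegree_critOrbit_lt hD)
  have hne : critOrbit D (n + k + 1) - critOrbit D (k + 1) ≠ 0 := by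
    intro h
    have h1 := hmono (show k < n + k by omega)
    simp only [sub_eq_zero.mp h, lt_irrefl] at h1
  refine (finite_setOfPred_isRoot hne).subset ?_
  rintro a ⟨⟨-, hper⟩, -⟩
  have h2 := Function.isPeriodicPt_minimalPeriod (unicritical D a) ((unicritical D a)^[k + 1] 0)
  rw [hper, Function.IsPeriodicPt, Function.IsFixedPt, ← Function.iterate_add_apply] at h2
  simp only [Set.mem_ofPred_eq, IsRoot.def, eval_sub, eval_critOrbit, sub_eq_zero]
  simpa [add_assoc] using h2

end UnicriticalPreperiodic

/-!
Write `D = p ^ e` and `d = p ^ (t + 1)`, `q = p ^ t`, and let `P j ∈ ℤ[X]` be the polynomial whose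
value at `a` is `f_a^j(0)`. The homogenised cyclotomic polynomial
`Φ(x, y) = ∑ i < p, x ^ (q i) y ^ (q (p - 1 - i))` vanishes at complex `x, y`, not both zero,
exactly when `x = ω y` with `ω` a primitive `d`-th root of unity. The parameters looked for are
therefore roots of `Φ(P (k + 1), P (k - 1))`. The other roots of this polynomial are those of
`B = Φ(P k, P (k - 1))`, where the period is one, and, for odd `k`, the point `-1`, where `0` is
periodic of period two; the latter is removed by dividing both arguments of `Φ` by `X + 1`. As
`P (k + 1) ≡ P k` modulo `B`, the polynomial `B` divides what is left, over `ℤ`; let `W` be the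
quotient (`exists_quotient`).

Modulo `p`, raising to the power `D` is additive, so that `P (k + 1) - P (k - 1)` and
`P k - P (k - 1)` are products of powers of `X` and `X + 1` (`exists_intCritOrbit_succ_sub_mod`,
`intCritOrbit_add_two_sub_mod`). With `Φ(x, y) ≡ (x - y) ^ ((p - 1) q)` this makes `W` a power of
`X + 1` modulo `p`. Moreover `W(-1) = Φ(1, 1) = p`. Thus `W` is an Eisenstein polynomial in the
variable `X + 1`, hence irreducible (`irreducible_of_map_eq_X_add_one_pow`).

It remains to see that the roots of `W`, which are simple by irreducibility, are the parameters. The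
only point that is not immediate is that `W` and `B` have no common root: otherwise `W` would divide
`B` in `ℤ[X]`, and evaluation at `-1` would give `p ∣ 1`.
-/

namespace UnicriticalPreperiodic

open Polynomial

/-! ### The homogenised cyclotomic polynomial of prime power order -/

/-- The homogenised cyclotomic polynomial `∏ (x - ω y)`, over the primitive `p * q`-th roots of
unity `ω`, for `p` prime and `q` a power of `p`, written as a geometric sum. -/
def homCyclotomic {R : Type*} [CommRing R] (p q : ℕ) (x y : R) : R :=
  ∑ i ∈ Finset.range p, (x ^ q) ^ i * (y ^ q) ^ (p - 1 - i)

section homCyclotomic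

variable {R S : Type*} [CommRing R] [CommRing S] (p q : ℕ)

theorem homCyclotomic_mul (x y : R) :
    homCyclotomic p q x y * (x ^ q - y ^ q) = x ^ (q * p) - y ^ (q * p) := by
  rw [homCyclotomic, geom_sum₂_mul, pow_mul, pow_mul]

theorem map_homCyclotomic (f : R →+* S) (x y : R) :
    f (homCyclotomic p q x y) = homCyclotomic p q (f x) (f y) := by
  simp [homCyclotomic]

theorem homCyclotomic_mul_mul (c x y : R) :
    homCyclotomic p q (c * x) (c * y) = c ^ (q * (p - 1)) * homCyclotomic p q x y := by
  rw [homCyclotomic, homCyclotomic, Finset.mul_sum]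
  refine Finset.sum_congr rfl fun i hi => ?_
  have h : p - 1 = i + (p - 1 - i) := by have := Finset.mem_range.mp hi; omega
  conv_rhs => rw [h, mul_add, pow_add]
  simp only [Nat.add_sub_cancel_left]
  ring

theorem homCyclotomic_one_one : homCyclotomic p q (1 : R) 1 = p := by
  simp [homCyclotomic]

variable {p q}

theorem homCyclotomic_zero_one (hp : p ≠ 0) (hq : q ≠ 0) : homCyclotomic p q (0 : R) 1 = 1 := by
  obtain ⟨p, rfl⟩ := Nat.exists_eq_succ_of_ne_zero hp
  simp [homCyclotomic, Finset.sum_range_succ', hq]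

theorem homCyclotomic_one_zero (hp : p ≠ 0) (hq : q ≠ 0) : homCyclotomic p q (1 : R) 0 = 1 := by
  obtain ⟨p, rfl⟩ := Nat.exists_eq_succ_of_ne_zero hp
  rw [homCyclotomic, Finset.sum_range_succ, Finset.sum_eq_zero]
  · simp
  · intro i hi
    have : p - i ≠ 0 := by have := Finset.mem_range.mp hi; omega
    simp [hq, this]

theorem homCyclotomic_eq_sub_pow [IsDomain R] [Fact p.Prime] [CharP R p] (t : ℕ) {x y : R}
    (hxy : x ≠ y) : homCyclotomic p (p ^ t) x y = (x - y) ^ (p ^ t * (p - 1)) := by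
  refine mul_right_cancel₀ (pow_ne_zero (p ^ t) (sub_ne_zero.mpr hxy)) ?_
  have hp : p - 1 + 1 = p := Nat.sub_add_cancel (Fact.out : p.Prime).one_le
  rw [← pow_add, sub_pow_char_pow, homCyclotomic_mul, ← pow_succ, ← sub_pow_char_pow]
  congr 1
  rw [pow_succ]
  nth_rewrite 2 [← hp]
  ring

theorem monic_homCyclotomic [IsDomain R] (hp : p ≠ 0) (hq : q ≠ 0) {x y : R[X]} (hx : x.Monic)
    (h : y.natDegree < x.natDegree) : (homCyclotomic p q x y).Monic := by
  have key : ∀ n : ℕ, n ≠ 0 → (x ^ n - y ^ n).Monic := fun n hn => by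
    refine (hx.pow n).sub_of_left (degree_lt_degree ?_)
    rw [natDegree_pow, natDegree_pow]
    exact Nat.mul_lt_mul_of_pos_left h (Nat.pos_of_ne_zero hn)
  refine (key q hq).of_mul_monic_right ?_
  rw [homCyclotomic_mul]
  exact key _ (mul_ne_zero hq hp)

theorem homCyclotomic_eq_zero_iff (hp : p.Prime) (t : ℕ) {x y : ℂ} (hy : y ≠ 0) :
    homCyclotomic p (p ^ t) x y = 0 ↔ ∃ ω : ℂ, IsPrimitiveRoot ω (p ^ (t + 1)) ∧ x = ω * y := by
  have := Fact.mk hp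
  have hne : NeZero ((p ^ (t + 1) : ℕ) : ℂ) := ⟨by exact_mod_cast pow_ne_zero _ hp.ne_zero⟩
  have key : ∀ ω : ℂ, homCyclotomic p (p ^ t) (ω * y) y = 0 ↔ IsPrimitiveRoot ω (p ^ (t + 1)) := by
    intro ω
    have h := homCyclotomic_mul_mul p (p ^ t) y ω 1
    rw [mul_one, mul_comm] at h
    rw [h, mul_eq_zero, or_iff_right (pow_ne_zero _ hy), ← isRoot_cyclotomic_iff,
      cyclotomic_prime_pow_eq_geom_sum hp]
    simp [homCyclotomic, eval_finsetSum]
  constructor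
  · intro h
    have hx : x = x / y * y := (div_mul_cancel₀ x hy).symm
    rw [hx] at h
    exact ⟨x / y, (key _).mp h, hx⟩
  · rintro ⟨ω, hω, rfl⟩
    exact (key ω).mpr hω

end homCyclotomic

/-! ### The critical orbit over the integers -/

/-- The polynomial `critOrbit D n`, with integer coefficients. -/
noncomputable def intCritOrbit (D : ℕ) : ℕ → ℤ[X]
  | 0 => 0
  | n + 1 => X * intCritOrbit D n ^ D + 1

theorem map_intCritOrbit (D n : ℕ) :
    (intCritOrbit D n).map (Int.castRingHom ℂ) = critOrbit D n := by
  induction n with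
  | zero => simp [intCritOrbit, critOrbit]
  | succ n ih => simp [intCritOrbit, critOrbit, ih]

theorem natDegree_intCritOrbit_lt {D : ℕ} (hD : 1 ≤ D) (n : ℕ) :
    (intCritOrbit D (n + 1)).natDegree < (intCritOrbit D (n + 2)).natDegree := by
  have h := natDegree_critOrbit_lt hD n
  simpa only [← map_intCritOrbit,
    natDegree_map_eq_of_injective (RingHom.injective_int (Int.castRingHom ℂ))] using h

theorem monic_intCritOrbit {D : ℕ} (hD : 1 ≤ D) (n : ℕ) : (intCritOrbit D (n + 1)).Monic := by
  induction n with
  | zero => simp [intCritOrbit, Nat.one_le_iff_ne_zero.mp hD]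
  | succ n ih =>
    rw [intCritOrbit]
    refine (monic_X.mul (ih.pow D)).add_of_left (degree_lt_degree ?_)
    rw [natDegree_one, natDegree_X_mul (ih.pow D).ne_zero]
    exact Nat.succ_pos _

/-- At the parameter `-1` the critical point has period two, and the even terms of the critical
orbit have derivative one there. -/
theorem X_add_one_sq_dvd_intCritOrbit {D : ℕ} (hD : 2 ≤ D) (m : ℕ) :
    (X + 1 : ℤ[X]) ^ 2 ∣ intCritOrbit D (2 * m + 1) - 1 ∧
      (X + 1 : ℤ[X]) ^ 2 ∣ intCritOrbit D (2 * m + 2) - (X + 1) := by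
  have step : ∀ j, (X + 1 : ℤ[X]) ^ 2 ∣ intCritOrbit D j - 1 →
      (X + 1 : ℤ[X]) ^ 2 ∣ intCritOrbit D (j + 1) - (X + 1) := fun j h => by
    have h1 : intCritOrbit D (j + 1) - (X + 1) = X * (intCritOrbit D j ^ D - 1 ^ D) := by
      rw [intCritOrbit]; ring
    rw [h1]
    exact (h.trans (sub_dvd_pow_sub_pow _ _ D)).mul_left _
  induction m with
  | zero =>
    have h : (X + 1 : ℤ[X]) ^ 2 ∣ intCritOrbit D 1 - 1 := by
      simp [intCritOrbit, show D ≠ 0 by omega]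
    exact ⟨h, step _ h⟩
  | succ m ih =>
    have h : (X + 1 : ℤ[X]) ^ 2 ∣ intCritOrbit D (2 * (m + 1) + 1) - 1 := by
      have h1 : (X + 1 : ℤ[X]) ∣ intCritOrbit D (2 * m + 2) := by
        have h2 := ((dvd_pow_self (X + 1 : ℤ[X]) two_ne_zero).trans ih.2).add (dvd_refl (X + 1))
        rwa [sub_add_cancel] at h2
      rw [show 2 * (m + 1) + 1 = (2 * m + 2) + 1 by ring, intCritOrbit, add_sub_cancel_right]
      exact ((pow_dvd_pow_of_dvd h1 2).trans (pow_dvd_pow _ hD)).mul_left _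
    exact ⟨h, step _ h⟩

theorem eval_neg_one_intCritOrbit_odd {D : ℕ} (hD : 2 ≤ D) (m : ℕ) :
    (intCritOrbit D (2 * m + 1)).eval (-1) = 1 := by
  obtain ⟨g, hg⟩ := (X_add_one_sq_dvd_intCritOrbit hD m).1
  simp [sub_eq_iff_eq_add.mp hg]

theorem exists_intCritOrbit_even_eq {D : ℕ} (hD : 2 ≤ D) (m : ℕ) :
    ∃ s : ℤ[X], intCritOrbit D (2 * m + 2) = (X + 1) * s ∧ s.eval (-1) = 1 := by
  obtain ⟨g, hg⟩ := (X_add_one_sq_dvd_intCritOrbit hD m).2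
  exact ⟨1 + (X + 1) * g, by linear_combination hg, by simp⟩

theorem eval_neg_one_intCritOrbit_even {D : ℕ} (hD : 2 ≤ D) (m : ℕ) :
    (intCritOrbit D (2 * m + 2)).eval (-1) = 0 := by
  obtain ⟨s, hs, -⟩ := exists_intCritOrbit_even_eq hD m
  simp [hs]

/-! ### The critical orbit modulo `p` -/

section mod

variable (p : ℕ) [Fact p.Prime] (e : ℕ)

/-- Modulo `p` the differences of the critical orbit transform by `u ↦ X * u ^ p ^ e`. -/
theorem intCritOrbit_succ_sub_succ_mod (i j : ℕ) :
    (intCritOrbit (p ^ e) (i + 1)).map (Int.castRingHom (ZMod p)) -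
        (intCritOrbit (p ^ e) (j + 1)).map (Int.castRingHom (ZMod p)) =
      X * ((intCritOrbit (p ^ e) i).map (Int.castRingHom (ZMod p)) -
        (intCritOrbit (p ^ e) j).map (Int.castRingHom (ZMod p))) ^ p ^ e := by
  rw [sub_pow_char_pow]
  simp only [intCritOrbit, Polynomial.map_add, Polynomial.map_mul, Polynomial.map_pow, map_X,
    Polynomial.map_one]
  ring

theorem exists_intCritOrbit_succ_sub_mod (j : ℕ) :
    ∃ m : ℕ, (intCritOrbit (p ^ e) (j + 1)).map (Int.castRingHom (ZMod p)) -
      (intCritOrbit (p ^ e) j).map (Int.castRingHom (ZMod p)) = X ^ m := by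
  induction j with
  | zero =>
    have hp : p ≠ 0 := (Fact.out : p.Prime).ne_zero
    exact ⟨0, by simp [intCritOrbit, hp]⟩
  | succ j ih =>
    obtain ⟨m, hm⟩ := ih
    exact ⟨m * p ^ e + 1, by rw [intCritOrbit_succ_sub_succ_mod, hm]; ring⟩

theorem intCritOrbit_add_two_sub_mod (j : ℕ) :
    (intCritOrbit (p ^ e) (j + 2)).map (Int.castRingHom (ZMod p)) -
        (intCritOrbit (p ^ e) j).map (Int.castRingHom (ZMod p)) =
      ((intCritOrbit (p ^ e) (j + 1)).map (Int.castRingHom (ZMod p)) -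
        (intCritOrbit (p ^ e) j).map (Int.castRingHom (ZMod p))) * (X + 1) ^ (p ^ e) ^ j := by
  induction j with
  | zero =>
    have hp : p ≠ 0 := (Fact.out : p.Prime).ne_zero
    simp [intCritOrbit, hp]
  | succ j ih =>
    rw [intCritOrbit_succ_sub_succ_mod, ih, intCritOrbit_succ_sub_succ_mod, mul_pow, ← pow_mul,
      ← pow_succ, mul_assoc]

end mod

/-! ### The quotient polynomial -/

/-- Eisenstein's criterion in the variable `X + 1`. -/
theorem irreducible_of_map_eq_X_add_one_pow {p : ℕ} [Fact p.Prime] {W : ℤ[X]} (hW : W.Monic) {n : ℕ}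
    (hmod : W.map (Int.castRingHom (ZMod p)) = (X + 1) ^ n) (heval : W.eval (-1) = p) :
    Irreducible W := by
  have hp : p.Prime := Fact.out
  have hX : (X + 1 : ℤ[X]) = X - C (-1) := by simp
  refine generalizedEisenstein (K := ZMod p) (q := X + 1) (p := n) ?_ ?_ hW.isPrimitive ?_ ?_ ?_ ?_
  · rw [hX, Polynomial.map_sub, map_X, map_C]
    exact irreducible_X_sub_C _
  · rw [hX]; exact monic_X_sub_C _
  · refine Nat.pos_of_ne_zero fun h0 => hp.one_lt.ne' ?_
    rw [hW.natDegree_eq_zero.mp h0, eval_one] at heval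
    exact_mod_cast heval.symm
  · simp [hW.leadingCoeff]
  · simpa [hW.leadingCoeff] using hmod
  · rw [hX, modByMonic_X_sub_C_eq_C_eval, heval, map_C]
    intro h
    have hker : RingHom.ker (algebraMap ℤ (ZMod p)) = Ideal.span {(p : ℤ)} := ZMod.ker_intCastRingHom p
    rw [C_eq_zero, Ideal.Quotient.eq_zero_iff_mem, hker, Ideal.span_singleton_pow,
      Ideal.mem_span_singleton] at h
    have h1 : p ^ 2 ∣ p := by exact_mod_cast h
    have h2 := Nat.le_of_dvd hp.pos h1
    nlinarith [hp.one_lt]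

theorem homCyclotomic_dvd_of_dvd_sub {R : Type*} [CommRing R] (p q : ℕ) {b x x' y : R}
    (hx : b ∣ x' - x) (hb : b ∣ homCyclotomic p q x y) : b ∣ homCyclotomic p q x' y := by
  rw [← Ideal.mem_span_singleton, ← Ideal.Quotient.eq_zero_iff_mem] at *
  rw [map_homCyclotomic] at *
  rw [map_sub, sub_eq_zero] at hx
  rwa [hx]

/-- Two consecutive terms related by a `p * q`-th root of unity are followed by a fixed point. -/
theorem homCyclotomic_dvd_intCritOrbit_sub {p q D : ℕ} (hqD : q * p ∣ D) (j : ℕ) :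
    homCyclotomic p q (intCritOrbit D (j + 1)) (intCritOrbit D j) ∣
      intCritOrbit D (j + 2) - intCritOrbit D (j + 1) := by
  have h : intCritOrbit D (j + 2) - intCritOrbit D (j + 1) =
      X * (intCritOrbit D (j + 1) ^ D - intCritOrbit D j ^ D) := by
    rw [intCritOrbit, intCritOrbit]; ring
  obtain ⟨c, rfl⟩ := hqD
  rw [h, pow_mul _ (q * p), pow_mul _ (q * p)]
  refine Dvd.dvd.mul_left ?_ _
  exact (Dvd.intro _ (homCyclotomic_mul p q _ _)).trans (sub_dvd_pow_sub_pow _ _ c)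

/-- For even `j` the terms `j` and `j + 2` of the critical orbit are divisible by `X + 1`, and the
homogenised cyclotomic polynomial, of degree `r = q * (p - 1)`, is divisible by `(X + 1) ^ r`; for
odd `j` both terms take the value `1` at `-1` and `r = 0`. -/
theorem exists_numerator {D p q : ℕ} (hD : 2 ≤ D) (hp : p ≠ 0) (hq : q ≠ 0) {j : ℕ} (hj : 1 ≤ j) :
    ∃ (A : ℤ[X]) (r : ℕ), r ≤ q * (p - 1) ∧ A.eval (-1) = p ∧
      homCyclotomic p q (intCritOrbit D (j + 2)) (intCritOrbit D j) = (X + 1) ^ r * A ∧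
      (homCyclotomic p q (intCritOrbit D (j + 1)) (intCritOrbit D j)).eval (-1) = 1 := by
  have hev : ∀ x y : ℤ[X], (homCyclotomic p q x y).eval (-1) =
      homCyclotomic p q (x.eval (-1)) (y.eval (-1)) := fun x y =>
    map_homCyclotomic p q (evalRingHom (-1)) x y
  rcases Nat.even_or_odd' j with ⟨m, rfl | rfl⟩
  · obtain ⟨m, rfl⟩ : ∃ n, m = n + 1 := ⟨m - 1, by omega⟩
    obtain ⟨s, hs, hs1⟩ := exists_intCritOrbit_even_eq hD m
    obtain ⟨s', hs', hs1'⟩ := exists_intCritOrbit_even_eq hD (m + 1)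
    refine ⟨homCyclotomic p q s' s, q * (p - 1), le_rfl, ?_, ?_, ?_⟩
    · rw [hev, hs1, hs1', homCyclotomic_one_one]
    · rw [← homCyclotomic_mul_mul, ← hs, ← hs']
      rfl
    · rw [hev, eval_neg_one_intCritOrbit_odd hD (m + 1), mul_add_one,
        eval_neg_one_intCritOrbit_even hD, homCyclotomic_one_zero hp hq]
  · refine ⟨_, 0, Nat.zero_le _, ?_, (by rw [pow_zero, one_mul]), ?_⟩
    · rw [hev, eval_neg_one_intCritOrbit_odd hD, show 2 * m + 1 + 2 = 2 * (m + 1) + 1 by ring,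
        eval_neg_one_intCritOrbit_odd hD, homCyclotomic_one_one]
    · rw [hev, eval_neg_one_intCritOrbit_odd hD, eval_neg_one_intCritOrbit_even hD,
        homCyclotomic_zero_one hp hq]

/-- The polynomial `W`, monic and irreducible, which will turn out to have the parameters of
preperiod `j + 1` and period two as its roots. -/
theorem exists_quotient {p : ℕ} (hp : p.Prime) {e t : ℕ} (hte : t + 1 ≤ e) {j : ℕ} (hj : 1 ≤ j) :
    ∃ (W : ℤ[X]) (r : ℕ), W.Monic ∧ Irreducible W ∧ W.eval (-1) = p ∧
      (homCyclotomic p (p ^ t) (intCritOrbit (p ^ e) (j + 1))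
        (intCritOrbit (p ^ e) j)).eval (-1) = 1 ∧
      homCyclotomic p (p ^ t) (intCritOrbit (p ^ e) (j + 2)) (intCritOrbit (p ^ e) j) =
        (X + 1) ^ r * (homCyclotomic p (p ^ t) (intCritOrbit (p ^ e) (j + 1))
          (intCritOrbit (p ^ e) j) * W) := by
  have := Fact.mk hp
  have hD : 2 ≤ p ^ e := hp.two_le.trans (Nat.le_self_pow (by omega) p)
  have hq : p ^ t ≠ 0 := pow_ne_zero _ hp.ne_zero
  have hX : (X + 1 : ℤ[X]) = X - C (-1) := by simp
  obtain ⟨A, r, hr, hA1, hA, hB1⟩ := exists_numerator hD hp.ne_zero hq hj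
  obtain ⟨i, rfl⟩ : ∃ i, j = i + 1 := ⟨j - 1, by omega⟩
  have hmon := monic_intCritOrbit (D := p ^ e) (by omega)
  have hlt := natDegree_intCritOrbit_lt (D := p ^ e) (by omega)
  have hBm : (homCyclotomic p (p ^ t) (intCritOrbit (p ^ e) (i + 1 + 1))
      (intCritOrbit (p ^ e) (i + 1))).Monic :=
    monic_homCyclotomic hp.ne_zero hq (hmon _) (hlt _)
  have hNm : (homCyclotomic p (p ^ t) (intCritOrbit (p ^ e) (i + 1 + 2))
      (intCritOrbit (p ^ e) (i + 1))).Monic :=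
    monic_homCyclotomic hp.ne_zero hq (hmon _) ((hlt _).trans (hlt _))
  have hdvd := homCyclotomic_dvd_of_dvd_sub p (p ^ t)
    (homCyclotomic_dvd_intCritOrbit_sub (pow_succ p t ▸ pow_dvd_pow p hte) (i + 1)) dvd_rfl
  obtain ⟨m, hm⟩ := exists_intCritOrbit_succ_sub_mod p e (i + 1)
  have hm2 := intCritOrbit_add_two_sub_mod p e (i + 1)
  -- The reductions modulo `p` of the denominator and of the numerator.
  have hX1 : (X + 1 : (ZMod p)[X]) ≠ 0 := by
    rw [← C_1]; exact X_add_C_ne_zero 1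
  have hBmod : (homCyclotomic p (p ^ t) (intCritOrbit (p ^ e) (i + 1 + 1))
      (intCritOrbit (p ^ e) (i + 1))).map (Int.castRingHom (ZMod p)) =
        (X ^ m) ^ (p ^ t * (p - 1)) := by
    rw [← hm, ← coe_mapRingHom, map_homCyclotomic, homCyclotomic_eq_sub_pow]
    rw [← sub_ne_zero, coe_mapRingHom, hm]
    exact pow_ne_zero _ X_ne_zero
  have hNmod : (homCyclotomic p (p ^ t) (intCritOrbit (p ^ e) (i + 1 + 2))
      (intCritOrbit (p ^ e) (i + 1))).map (Int.castRingHom (ZMod p)) =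
        (X ^ m * (X + 1) ^ (p ^ e) ^ (i + 1)) ^ (p ^ t * (p - 1)) := by
    rw [← hm, ← hm2, ← coe_mapRingHom, map_homCyclotomic, homCyclotomic_eq_sub_pow]
    rw [← sub_ne_zero, coe_mapRingHom, hm2, hm]
    exact mul_ne_zero (pow_ne_zero _ X_ne_zero) (pow_ne_zero _ hX1)
  generalize homCyclotomic p (p ^ t) (intCritOrbit (p ^ e) (i + 1 + 2))
    (intCritOrbit (p ^ e) (i + 1)) = N at *
  generalize homCyclotomic p (p ^ t) (intCritOrbit (p ^ e) (i + 1 + 1))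
    (intCritOrbit (p ^ e) (i + 1)) = B at *
  -- `B` is coprime to `X + 1` since it takes the value `1` at `-1`.
  have hcop : IsCoprime B ((X + 1) ^ r) := by
    refine IsCoprime.pow_right ?_
    obtain ⟨g, hg⟩ := X_sub_C_dvd_sub_C_eval (p := B) (a := -1)
    rw [hB1, ← hX, C_1] at hg
    exact ⟨1, -g, by linear_combination hg⟩
  obtain ⟨W, rfl⟩ : B ∣ A := hcop.dvd_of_dvd_mul_left (hA ▸ hdvd)
  have hWm : W.Monic := by
    rw [hA] at hNm
    refine hBm.of_mul_monic_left (Monic.of_mul_monic_left (p := (X + 1) ^ r) ?_ hNm)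
    rw [hX]; exact (monic_X_sub_C _).pow r
  have hW1 : W.eval (-1) = p := by simpa [hB1] using hA1
  have hle : r ≤ (p ^ e) ^ (i + 1) * (p ^ t * (p - 1)) :=
    hr.trans (Nat.le_mul_of_pos_left _ (pow_pos (pow_pos hp.pos e) _))
  have hWmod : W.map (Int.castRingHom (ZMod p)) =
      (X + 1) ^ ((p ^ e) ^ (i + 1) * (p ^ t * (p - 1)) - r) := by
    rw [hA, Polynomial.map_mul, Polynomial.map_mul, hBmod] at hNmod
    have h0 : (X + 1 : (ZMod p)[X]) ^ r * (X ^ m) ^ (p ^ t * (p - 1)) ≠ 0 :=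
      mul_ne_zero (pow_ne_zero _ hX1) (pow_ne_zero _ (pow_ne_zero _ X_ne_zero))
    refine mul_left_cancel₀ h0 ?_
    rw [mul_right_comm _ _ ((X + 1) ^ (_ - r)), ← pow_add, Nat.add_sub_cancel' hle, pow_mul (X + 1),
      mul_comm, ← mul_assoc, mul_comm (W.map _)]
    rw [mul_pow] at hNmod
    simp only [Polynomial.map_pow, Polynomial.map_add, map_X, Polynomial.map_one] at hNmod
    linear_combination hNmod
  exact ⟨W, r, hWm, irreducible_of_map_eq_X_add_one_pow hWm hWmod hW1, hW1, hB1, hA⟩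

/-- By Gauss's lemma `W` is the minimal polynomial over `ℤ` of each of its roots. -/
theorem aeval_ne_zero_of_not_dvd {W B : ℤ[X]} (hW : W.Monic) (hirr : Irreducible W)
    (h : ¬ W ∣ B) {a : ℂ} (ha : aeval a W = 0) : aeval a B ≠ 0 := by
  intro hB
  have hint : IsIntegral ℤ a := ⟨W, hW, ha⟩
  obtain ⟨c, hc⟩ := minpoly.isIntegrallyClosed_dvd hint ha
  have hu : IsUnit c := (hirr.isUnit_or_isUnit hc).resolve_left (minpoly.not_isUnit ℤ a)
  refine h ?_
  rw [hc, hu.mul_right_dvd]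
  exact minpoly.isIntegrallyClosed_dvd hint hB

/-! ### Parameters -/

theorem aeval_intCritOrbit (D : ℕ) (a : ℂ) (n : ℕ) :
    aeval a (intCritOrbit D n) = (unicritical D a)^[n] 0 := by
  rw [← eval_critOrbit, ← map_intCritOrbit, eval_map, aeval_def]
  rfl

/-- The parameters read off from the terms `j`, `j + 1` and `j + 2` of the critical orbit. The two
inequalities exclude that `0` itself has period two, and that the term `j + 1` is a fixed point. -/
theorem mem_params_two_iff {D : ℕ} (hD : 2 ≤ D) {d : ℕ} (hd : 2 ≤ d) (hdD : d ∣ D) {j : ℕ}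
    (hj : 1 ≤ j) (a : ℂ) :
    a ∈ params D (j + 1) 2 d ↔ a ≠ -1 ∧ (unicritical D a)^[j + 2] 0 ≠ (unicritical D a)^[j + 1] 0 ∧
      ∃ ω : ℂ, IsPrimitiveRoot ω d ∧
        (unicritical D a)^[j + 2] 0 = ω * (unicritical D a)^[j] 0 := by
  have hD0 : D ≠ 0 := by omega
  set f := unicritical D a with hf
  have hf0 : f 0 = 1 := by simp [hf, unicritical, hD0]
  have hpt : ∀ n m : ℕ, f^[n] (f^[m] 0) = f^[m + n] 0 := fun n m => by
    rw [add_comm, Function.iterate_add_apply]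
  have hneg : a = -1 → f^[2] 0 = 0 := by
    rintro rfl
    simp [hf, unicritical, hD0]
  have hneg' : f^[2] 0 = 0 → a = -1 := by
    intro h
    simp only [Function.iterate_succ, Function.iterate_zero, Function.comp_apply, id, hf0] at h
    simp only [hf, unicritical, one_pow, mul_one] at h
    linear_combination h
  rw [params, Set.mem_ofPred_eq]
  constructor
  · rintro ⟨⟨⟨hper, hleast⟩, hmin⟩, ω, hω, h⟩
    refine ⟨fun ha => ?_, fun heq => ?_, ω, hω, h⟩
    · have : (0 : ℕ) ∈ {j : ℕ | f^[j] 0 ∈ Function.periodicPts f} :=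
        Function.mk_mem_periodicPts two_pos (hneg ha)
      have := hleast this
      omega
    · have h1 : Function.IsPeriodicPt f 1 (f^[j + 1] 0) := by
        rw [Function.IsPeriodicPt, Function.IsFixedPt, hpt]; exact heq
      have h2 := h1.minimalPeriod_dvd
      rw [hmin] at h2
      omega
  · rintro ⟨ha, hne, ω, hω, h⟩
    have hωD : ω ^ D = 1 := by
      obtain ⟨c, rfl⟩ := hdD
      rw [pow_mul, hω.pow_eq_one, one_pow]
    have h3 : f^[j + 3] 0 = f^[j + 1] 0 := by
      rw [Function.iterate_succ_apply' f (j + 2), Function.iterate_succ_apply' f j, h]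
      simp [hf, unicritical, mul_pow, hωD]
    have hper : Function.IsPeriodicPt f 2 (f^[j + 1] 0) := by
      rw [Function.IsPeriodicPt, Function.IsFixedPt, hpt]; exact h3
    have hmin : Function.minimalPeriod f (f^[j + 1] 0) = 2 := by
      refine Function.minimalPeriod_eq_prime hper fun hfix => hne ?_
      rw [Function.iterate_succ_apply' f (j + 1)]; exact hfix
    refine ⟨⟨⟨Function.mk_mem_periodicPts two_pos hper, fun i hi => ?_⟩, hmin⟩, ω, hω, h⟩
    by_contra! hlt
    -- Otherwise the term `j` is periodic too; its period is two, as it leads to the term `j + 1`.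
    have hjper : f^[j] 0 ∈ Function.periodicPts f := by
      have h4 : f^[j] 0 = f^[j - i] (f^[i] 0) := by rw [hpt]; congr 2; omega
      obtain ⟨n, hn, hn'⟩ := hi
      rw [h4]
      exact ⟨n, hn, hn'.apply_iterate _⟩
    have h2 : f^[j + 2] 0 = f^[j] 0 := by
      have h5 := Function.minimalPeriod_apply hjper
      rw [← Function.iterate_succ_apply' f j, hmin] at h5
      have h6 := Function.isPeriodicPt_minimalPeriod f (f^[j] 0)
      rw [← h5, Function.IsPeriodicPt, Function.IsFixedPt, hpt] at h6
      exact h6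
    have h0 : f^[j] 0 = 0 := by
      have h7 : (1 - ω) * f^[j] 0 = 0 := by linear_combination h - h2
      refine (mul_eq_zero.mp h7).resolve_left fun h8 => ?_
      exact hω.ne_one (by omega) (sub_eq_zero.mp h8).symm
    refine ha (hneg' ?_)
    have h9 := hpt 2 j
    rwa [h2, h0] at h9

end UnicriticalPreperiodic

open Polynomial UnicriticalPreperiodic in
theorem mainTheorem4 (D : ℕ) (hD : IsPrimePow D) (k : ℕ) (hk : 2 ≤ k)
    (d : ℕ) (hd : 2 ≤ d) (hdD : d ∣ D) :
    ∃ Q : Polynomial ℤ,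
      Q.map (Int.castRingHom ℂ) = UnicriticalPreperiodic.R D k 2 d ∧
      Irreducible (Q.map (Int.castRingHom ℚ)) := by
  obtain ⟨p, e, hp, he, rfl⟩ := (isPrimePow_nat_iff D).mp hD
  obtain ⟨s, hs, rfl⟩ := (Nat.dvd_prime_pow hp).mp hdD
  obtain ⟨t, rfl⟩ : ∃ t, s = t + 1 := ⟨s - 1, by rcases s with _ | s <;> simp_all⟩
  obtain ⟨j, rfl⟩ : ∃ j, k = j + 1 := ⟨k - 1, by omega⟩
  have hD2 : 2 ≤ p ^ e := hp.two_le.trans (Nat.le_self_pow (by omega) p)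
  have hj : 1 ≤ j := by omega
  obtain ⟨W, r, hWm, hirr, hW1, hB1, hA⟩ := exists_quotient hp hs hj
  have hirrQ : Irreducible (W.map (Int.castRingHom ℚ)) :=
    hWm.irreducible_iff_irreducible_map_fraction_map.mp hirr
  refine ⟨W, ?_, hirrQ⟩
  have hnd : ¬ W ∣ homCyclotomic p (p ^ t) (intCritOrbit (p ^ e) (j + 1))
      (intCritOrbit (p ^ e) j) := by
    rintro ⟨c, hc⟩
    rw [hc, eval_mul, hW1] at hB1
    exact hp.one_lt.ne' (by exact_mod_cast Int.eq_one_of_mul_eq_one_right (by positivity) hB1)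
  have hsucc : ∀ (a : ℂ) (n : ℕ), (unicritical (p ^ e) a)^[n + 1] 0 =
      a * ((unicritical (p ^ e) a)^[n] 0) ^ p ^ e + 1 := fun a n => by
    rw [Function.iterate_succ_apply']; rfl
  have hmem : ∀ a : ℂ, a ∈ params (p ^ e) (j + 1) 2 (p ^ (t + 1)) ↔ aeval a W = 0 := by
    intro a
    have haA := congrArg (aeval a) hA
    have haB := homCyclotomic_dvd_intCritOrbit_sub (D := p ^ e)
      (pow_succ p t ▸ pow_dvd_pow p hs) j
    have hhom : ∀ x y : ℤ[X], aeval a (homCyclotomic p (p ^ t) x y) =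
        homCyclotomic p (p ^ t) (aeval a x) (aeval a y) := fun x y =>
      map_homCyclotomic p (p ^ t) (aeval a : ℤ[X] →ₐ[ℤ] ℂ).toRingHom x y
    have hne := fun h => aeval_ne_zero_of_not_dvd hWm hirr hnd (a := a) h
    have haB' := map_dvd (aeval a : ℤ[X] →ₐ[ℤ] ℂ) haB
    rw [map_mul, map_mul, map_pow, map_add, aeval_X, map_one] at haA
    rw [map_sub] at haB'
    rw [hhom, aeval_intCritOrbit, aeval_intCritOrbit] at haA haB' hne
    rw [hhom, aeval_intCritOrbit, aeval_intCritOrbit] at haA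
    rw [aeval_intCritOrbit] at haB'
    rw [mem_params_two_iff hD2 hd hdD hj]
    have hq : p ^ t ≠ 0 := pow_ne_zero _ hp.ne_zero
    -- The terms `j` and `j + 2` vanish together only when `0` has period two.
    have hu : (unicritical (p ^ e) a)^[j] 0 = 0 → (unicritical (p ^ e) a)^[j + 2] 0 = 0 →
        a = -1 := fun h0 h2 => by
      rw [hsucc a (j + 1), hsucc a j, h0, zero_pow (by omega), mul_zero, zero_add, one_pow,
        mul_one] at h2
      exact eq_neg_of_add_eq_zero_left h2
    generalize (unicritical (p ^ e) a)^[j] 0 = u at *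
    generalize (unicritical (p ^ e) a)^[j + 1] 0 = v at *
    generalize (unicritical (p ^ e) a)^[j + 2] 0 = w at *
    constructor
    · rintro ⟨ha, hfix, ω, hω, h⟩
      have hu0 : u ≠ 0 := fun h0 => ha (hu h0 (by rw [h, h0, mul_zero]))
      rw [(homCyclotomic_eq_zero_iff hp t hu0).mpr ⟨ω, hω, h⟩] at haA
      have ha' : (a + 1) ^ r ≠ 0 := pow_ne_zero _ fun h => ha (eq_neg_of_add_eq_zero_left h)
      have hv : homCyclotomic p (p ^ t) v u ≠ 0 := fun h =>
        hfix (sub_eq_zero.mp (zero_dvd_iff.mp (h ▸ haB')))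
      exact (mul_eq_zero.mp ((mul_eq_zero.mp haA.symm).resolve_left ha')).resolve_left hv
    · intro hW
      have hv := hne hW
      rw [hW, mul_zero, mul_zero] at haA
      have ha : a ≠ -1 := by
        rintro rfl
        have h1 : aeval (-1 : ℂ) W = ((W.eval (-1) : ℤ) : ℂ) := by
          simpa using aeval_algebraMap_apply ℂ (-1 : ℤ) W
        rw [h1, hW1] at hW
        exact hp.ne_zero (by exact_mod_cast hW)
      have hu0 : u ≠ 0 := by
        rintro rfl
        have h1 := homCyclotomic_mul_mul p (p ^ t) w 1 0
        rw [mul_one, mul_zero, haA, homCyclotomic_one_zero hp.ne_zero hq, mul_one] at h1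
        exact ha (hu rfl (eq_zero_of_pow_eq_zero h1.symm))
      exact ⟨ha, fun h => hv (h ▸ haA), (homCyclotomic_eq_zero_iff hp t hu0).mp haA⟩
  have hsplit := (IsAlgClosed.splits (W.map (Int.castRingHom ℂ))).eq_prod_roots_of_monic
    (hWm.map _)
  have hnodup : (W.map (Int.castRingHom ℂ)).roots.Nodup := by
    have h := hirrQ.separable.map (f := algebraMap ℚ ℂ)
    rw [Polynomial.map_map, RingHom.eq_intCast' ((algebraMap ℚ ℂ).comp _)] at h
    exact nodup_roots h
  have hset : params (p ^ e) (j + 1) 2 (p ^ (t + 1)) =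
      (W.map (Int.castRingHom ℂ)).roots.toFinset := by
    ext a
    rw [hmem, Finset.mem_coe, Multiset.mem_toFinset, mem_roots (hWm.map _).ne_zero, IsRoot.def,
      eval_map, aeval_def]
    rfl
  rw [R, hset, finprod_mem_coe_finset, Finset.prod_eq_multiset_prod, Multiset.toFinset_val,
    hnodup.dedup]
  exact hsplit
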